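/- All germs below are germs at $+\infty$ of real valued functions on half-lines. Let $\mathcal C$ be the ring of germs of continuous functions $[a,+\infty)\to\mathbb R$ ($a\in\mathbb R$), and let $\mathcal C^\infty$ be its subring of germs of infinitely differentiable functions $[a,+\infty)\to\mathbb R$ ($a\in\mathbb R$). For germs $g,h$ write $g<_{\mathrm e}h$ if $g(t)<h(t)$ for all sufficiently large $t$. A \emph{Hardy field} is a subring, containing $1$, of the ring of germs of differentiable functions $(a,+\infty)\to\mathbb R$ ($a\in\mathbb R$) that is a field and is closed under differentiation. A Hardy field $H$ that contains (the germs of) all real constants is \emph{Liouville closed} if it is real closed and for every $f\in H$ there are $g\in H$ with $g'=f$ and $z\in H$, $z\neq 0$, with $z'/z=f$. \textbf{Theorem.} Let $H\supseteq\mathbb R$ be a Liouville closed Hardy field, and let $\phi\in\mathcal C$ satisfy $h<_{\mathrm e}\phi$ for all $h\in H$. Then there is a $y\in\mathcal C^\infty$ with $\phi<_{\mathrm e}y$ that generates a Hardy field $H\langle y\rangle$ over $H$; that is, among the Hardy fields that extend $H$ and contain $y$ there is a smallest one, $H\langle y\rangle$. -/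

import Mathlib

namespace HardyFields

open Filter Topology

/-- The ring of germs at `+∞` of real valued functions. A function on a half-line `[a, +∞)` or
`(a, +∞)` has a germ here: that of any of its extensions to `ℝ`. -/
abbrev RGerm : Type := Germ (atTop : Filter ℝ) ℝ

/-- `g <ₑ h`: `g(t) < h(t)` for all sufficiently large `t`. (This is stronger than the strict
order `g < h` of `RGerm`, which only says `g ≤ h` and `g ≠ h`.) -/
def EventuallyLT (g h : RGerm) : Prop := Germ.LiftRel (· < ·) g h

/-- The germs of `r` times continuously differentiable functions `[a, +∞) → ℝ`, where `a` is real
and `r` is a natural number or `∞`. -/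
def smoothGerms (r : ℕ∞) : Set RGerm :=
  {f | ∃ (a : ℝ) (F : ℝ → ℝ), ContDiffOn ℝ r F (Set.Ici a) ∧ f = (F : RGerm)}

/-- The germs of continuous functions `[a, +∞) → ℝ`, where `a` is real. -/
def continuousGerms : Set RGerm :=
  {f | ∃ (a : ℝ) (F : ℝ → ℝ), ContinuousOn F (Set.Ici a) ∧ f = (F : RGerm)}

/-- The germs of differentiable functions `(a, +∞) → ℝ`, where `a` is real. -/
def differentiableGerms : Set RGerm :=
  {f | ∃ (a : ℝ) (F : ℝ → ℝ), DifferentiableOn ℝ F (Set.Ioi a) ∧ f = (F : RGerm)}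

theorem deriv_eventuallyEq {F G : ℝ → ℝ} (h : F =ᶠ[atTop] G) : deriv F =ᶠ[atTop] deriv G := by
  obtain ⟨a, ha⟩ := eventually_atTop.1 h
  filter_upwards [eventually_gt_atTop a] with t ht
  apply Filter.EventuallyEq.deriv_eq
  filter_upwards [Ioi_mem_nhds ht] with s hs
  exact ha s (le_of_lt hs)

/-- The germ of the derivative of a function. It is only used for differentiable germs. -/
noncomputable def germDeriv (f : RGerm) : RGerm :=
  Germ.map' deriv (fun _ _ h => deriv_eventuallyEq h) f

/-- A Hardy field: a subring of the ring of germs of differentiable functions on half-lines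
`(a, +∞)` that is a field and is closed under differentiation. -/
structure IsHardyField (H : Subring RGerm) : Prop where
  differentiable : ∀ f ∈ H, f ∈ differentiableGerms
  isField : IsField H
  deriv_mem : ∀ f ∈ H, germDeriv f ∈ H

/-- `H` contains the (germs of the) real constants. -/
def ContainsReals (H : Subring RGerm) : Prop :=
  ∀ c : ℝ, ((fun _ : ℝ => c : ℝ → ℝ) : RGerm) ∈ H

/-- A Hardy field is Liouville closed if it is real closed, each of its elements has an
antiderivative in it, and each of its elements is the logarithmic derivative `z' / z` of some
nonzero element `z`. -/
structure IsLiouvilleClosed (H : Subring RGerm) : Prop extends IsHardyField H where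
  realClosed : letI : Field H := isField.toField; IsRealClosed H
  exists_antiderivative : ∀ f ∈ H, ∃ g ∈ H, germDeriv g = f
  exists_logDeriv : ∀ f ∈ H, ∃ z ∈ H, z ≠ 0 ∧ germDeriv z = f * z

/-- `y` generates the Hardy field `K = H⟨y⟩` over `H`: among the Hardy fields that extend `H` and
contain `y`, `K` is the smallest one. -/
def GeneratesOver (H : Subring RGerm) (y : RGerm) (K : Subring RGerm) : Prop :=
  IsLeast {L : Subring RGerm | IsHardyField L ∧ H ≤ L ∧ y ∈ L} K

end HardyFields

/-!
The germ `y` is the first member of a sequence `y = y₀, y₁, y₂, …` with `yₙ' = yₙ yₙ₊₁` in which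
each `yₙ` exceeds all elements of `H` and all powers of `yₙ₊₁`. The ring generated by `H` and the
`yₙ` is closed under differentiation, so its fractions form a Hardy field as soon as its nonzero
elements are units among the germs; intersecting all Hardy fields that contain `H` and `y` then
gives `H⟨y⟩`. An element of this ring involves only `y₀, …, yₙ` for some `n`. Adjoin these to `H` in
the order `yₙ, …, y₀`: each of them dominates the ring obtained so far, so the sign of a polynomial
in it is that of the leading coefficient, and a nonzero `f` ends up with `1 ≤ f y₀` or
`1 ≤ -f y₀`.

To construct the sequence, let the function `fₖ` be a large constant `cₖ` up to time `k`, pass to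
logarithmic derivative `cₖ₊₁` during `[k, k + 1]`, and obey `fₖ' = fₖ fₖ₊₁` from then on. The system
is solvable since at each time only finitely many `fₖ` have started to grow. The invariant
`2 fₖ' / fₖ ≤ fₖ` on `[k, ∞)` makes `fₖ₊₁² / fₖ` decrease on `[k + 1, ∞)`, so `fₖ₊₁² ≤ fₖ` there. In
particular `m fₖ₊₂ ≤ fₖ₊₁` eventually, and the same monotonicity argument with `fₖ₊₁ᵐ / fₖ` shows
`fₖ₊₁ᵐ ≤ fₖ` eventually, for every `m`.
-/

namespace HardyFields

open Filter Topology Polynomial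

/-! ### Subrings and subfields of a commutative ring -/

section Subrings

variable {A : Type*} [CommRing A]

theorem isField_iff_exists_mul_eq_one [Nontrivial A] {K : Subring A} :
    IsField K ↔ ∀ f ∈ K, f ≠ 0 → ∃ g ∈ K, f * g = 1 := by
  refine ⟨fun hK f hf hf0 => ?_, fun h => ⟨exists_pair_ne K, mul_comm, ?_⟩⟩
  · obtain ⟨g, hg⟩ := hK.mul_inv_cancel (a := ⟨f, hf⟩) fun h => hf0 (congrArg Subtype.val h)
    exact ⟨g, g.2, congrArg Subtype.val hg⟩
  · rintro ⟨f, hf⟩ hf0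
    obtain ⟨g, hg, hfg⟩ := h f hf fun h => hf0 (Subtype.ext h)
    exact ⟨⟨g, hg⟩, Subtype.ext hfg⟩

/-- The subring of all fractions `u / v` with `u, v ∈ R`, where `v` is a unit of the ambient
ring; such a fraction is the solution `g` of `g * v = u`. -/
def fractionSubring (R : Subring A) : Subring A where
  carrier := {g | ∃ u ∈ R, ∃ v ∈ R, IsUnit v ∧ g * v = u}
  mul_mem' := by
    rintro a b ⟨_, hu, v, hv, hv', rfl⟩ ⟨_, hw, x, hx, hx', rfl⟩
    exact ⟨_, R.mul_mem hu hw, v * x, R.mul_mem hv hx, hv'.mul hx', by ring⟩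
  one_mem' := ⟨1, R.one_mem, 1, R.one_mem, isUnit_one, one_mul 1⟩
  add_mem' := by
    rintro a b ⟨_, hu, v, hv, hv', rfl⟩ ⟨_, hw, x, hx, hx', rfl⟩
    exact ⟨_, R.add_mem (R.mul_mem hu hx) (R.mul_mem hw hv), v * x, R.mul_mem hv hx,
      hv'.mul hx', by ring⟩
  zero_mem' := ⟨0, R.zero_mem, 1, R.one_mem, isUnit_one, zero_mul 1⟩
  neg_mem' := by
    rintro a ⟨_, hu, v, hv, hv', rfl⟩
    exact ⟨_, R.neg_mem hu, v, hv, hv', by ring⟩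

theorem le_fractionSubring (R : Subring A) : R ≤ fractionSubring R :=
  fun g hg => ⟨g, hg, 1, R.one_mem, isUnit_one, mul_one g⟩

theorem isField_fractionSubring [Nontrivial A] {R : Subring A}
    (hR : ∀ v ∈ R, v ≠ 0 → IsUnit v) : IsField (fractionSubring R) := by
  refine isField_iff_exists_mul_eq_one.2 ?_
  rintro g ⟨u, hu, v, hv, hv', hgv⟩ hg0
  have hu' : IsUnit u := hR u hu fun hu0 => hg0 (hv'.mul_left_eq_zero.1 (hgv.trans hu0))
  obtain ⟨w, hw⟩ := hu'.exists_right_inv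
  refine ⟨v * w, ⟨v, hv, u, hu, hu', ?_⟩, ?_⟩
  · linear_combination v * hw
  · rw [← mul_assoc, hgv, hw]

theorem isField_sInf [Nontrivial A] {S : Set (Subring A)} (hS : S.Nonempty)
    (h : ∀ K ∈ S, IsField K) : IsField (sInf S : Subring A) := by
  refine isField_iff_exists_mul_eq_one.2 fun f hf hf0 => ?_
  rw [Subring.mem_sInf] at hf
  have hinv : ∀ K ∈ S, ∃ g ∈ K, f * g = 1 := fun K hK =>
    isField_iff_exists_mul_eq_one.1 (h K hK) f (hf K hK) hf0
  obtain ⟨K₀, hK₀⟩ := hS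
  obtain ⟨g, -, hfg⟩ := hinv K₀ hK₀
  refine ⟨g, Subring.mem_sInf.2 fun K hK => ?_, hfg⟩
  obtain ⟨g', hg', hfg'⟩ := hinv K hK
  rwa [(IsUnit.of_mul_eq_one g hfg).mul_left_cancel (hfg.trans hfg'.symm)]

theorem le_adjoin_toSubring (R : Subring A) (y : A) : R ≤ (Algebra.adjoin R {y}).toSubring :=
  fun f hf => (Algebra.adjoin R {y}).algebraMap_mem ⟨f, hf⟩

theorem exists_mem_closure_union_image_Iic {s : Set A} {y : ℕ → A} {f : A}
    (hf : f ∈ Subring.closure (s ∪ Set.range y)) :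
    ∃ n, f ∈ Subring.closure (s ∪ y '' Set.Iic n) := by
  have hmono : Monotone fun n => Subring.closure (s ∪ y '' Set.Iic n) := fun m n hmn =>
    Subring.closure_mono
      (Set.union_subset_union_right s (Set.image_mono (Set.Iic_subset_Iic.2 hmn)))
  rwa [← Subring.mem_iSup_of_directed hmono.directed_le, ← Subring.closure_iUnion,
    ← Set.union_iUnion, ← Set.image_iUnion, Set.iUnion_Iic, Set.image_univ]

end Subrings

/-! ### Elements dominating a subring of an ordered ring -/

section Domination

variable {A : Type*} [CommRing A] [PartialOrder A] [IsOrderedRing A] [Nontrivial A]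

theorem leadingCoeff_divX {S : Type*} [Semiring S] {P : S[X]} (hP : P.natDegree ≠ 0) :
    P.divX.leadingCoeff = P.leadingCoeff := by
  rw [leadingCoeff, coeff_divX, natDegree_divX_eq_natDegree_tsub_one,
    Nat.sub_add_cancel (Nat.one_le_iff_ne_zero.2 hP), leadingCoeff]

/-- Every element of `R` is comparable with `0`, and `y` dominates every quotient `b / f` with
`b, f ∈ R` and `f > 0`. This is stated without division, as `f` need not be invertible. -/
structure Dominates (R : Subring A) (y : A) : Prop where
  nonneg_or_nonpos : ∀ f ∈ R, 0 ≤ f ∨ f ≤ 0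
  le_mul : ∀ f ∈ R, 0 < f → ∀ b ∈ R, b ≤ f * y

namespace Dominates

variable {R : Subring A} {y z : A}

theorem of_isField {K : Subring A} (hK : IsField K) (hsign : ∀ f ∈ K, 0 ≤ f ∨ f ≤ 0)
    (hy : ∀ f ∈ K, f ≤ y) : Dominates K y where
  nonneg_or_nonpos := hsign
  le_mul f hf hf0 b hb := by
    obtain ⟨g, hg, hfg⟩ := isField_iff_exists_mul_eq_one.1 hK f hf hf0.ne'
    calc b = f * (g * b) := by rw [← mul_assoc, hfg, one_mul]
      _ ≤ f * y := mul_le_mul_of_nonneg_left (hy _ (K.mul_mem hg hb)) hf0.le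

theorem le (h : Dominates R y) {b : A} (hb : b ∈ R) : b ≤ y := by
  simpa only [one_mul] using h.le_mul 1 R.one_mem one_pos b hb

theorem one_le (h : Dominates R y) : 1 ≤ y := h.le R.one_mem

-- Horner's scheme: `P(y) = Q(y) y + P(0)` with `Q(y) y` dominating `R`.
theorem aeval_pos_and_le_mul (h : Dominates R y) (P : R[X]) (hP : 0 < (P.leadingCoeff : A)) :
    0 < aeval y P ∧ ∀ b ∈ R, b ≤ aeval y P * y := by
  induction hn : P.natDegree generalizing P with
  | zero =>
    obtain ⟨r, rfl⟩ := natDegree_eq_zero.1 hn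
    rw [leadingCoeff_C] at hP
    rw [aeval_C]
    exact ⟨hP, h.le_mul r r.2 hP⟩
  | succ n ih =>
    obtain ⟨-, hQ⟩ := ih P.divX
      (by rwa [leadingCoeff_divX (by omega)])
      (by rw [natDegree_divX_eq_natDegree_tsub_one, hn, Nat.add_sub_cancel])
    have horner : aeval y P = aeval y P.divX * y + (P.coeff 0 : A) := by
      conv_lhs => rw [← divX_mul_X_add P, map_add, map_mul, aeval_X, aeval_C]
      rfl
    have one_le_aeval : 1 ≤ aeval y P := by
      rw [horner, ← sub_le_iff_le_add]
      exact hQ _ (R.sub_mem R.one_mem (P.coeff 0).2)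
    exact ⟨one_pos.trans_le one_le_aeval, fun b hb =>
      (h.le hb).trans (le_mul_of_one_le_left (zero_le_one.trans h.one_le) one_le_aeval)⟩

theorem pos_or_neg_of_mem_adjoin (h : Dominates R y) {f : A} (hf : f ∈ Algebra.adjoin R {y}) :
    f = 0 ∨ (0 < f ∧ 1 ≤ f * y) ∨ (f < 0 ∧ 1 ≤ -f * y) := by
  rw [Algebra.adjoin_singleton_eq_range_aeval] at hf
  obtain ⟨P, rfl⟩ := hf
  rcases eq_or_ne P 0 with rfl | hP
  · exact .inl (map_zero _)
  have hlc : (P.leadingCoeff : A) ≠ 0 := fun h0 =>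
    hP (leadingCoeff_eq_zero.1 (Subtype.ext h0))
  rcases h.nonneg_or_nonpos _ P.leadingCoeff.2 with hpos | hneg
  · have := h.aeval_pos_and_le_mul P (hpos.lt_of_ne' hlc)
    exact .inr (.inl ⟨this.1, this.2 1 R.one_mem⟩)
  · have := h.aeval_pos_and_le_mul (-P) (by
      rw [leadingCoeff_neg]
      exact neg_pos.2 (hneg.lt_of_ne hlc))
    rw [map_neg] at this
    exact .inr (.inr ⟨neg_pos.1 this.1, this.2 1 R.one_mem⟩)

theorem exists_le_pow_of_mem_adjoin (h : Dominates R y) {f : A} (hf : f ∈ Algebra.adjoin R {y}) :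
    ∃ m : ℕ, f ≤ y ^ m := by
  rw [Algebra.adjoin_singleton_eq_range_aeval] at hf
  obtain ⟨P, rfl⟩ := hf
  induction P using Polynomial.induction_on' with
  | add P Q hP hQ =>
    obtain ⟨m, hm⟩ := hP
    obtain ⟨n, hn⟩ := hQ
    have two_le : 2 ≤ y := h.le (ofNat_mem R 2)
    refine ⟨m + n + 1, ?_⟩
    calc aeval y (P + Q) ≤ y ^ m + y ^ n := by rw [map_add]; exact add_le_add hm hn
      _ ≤ y ^ (m + n) + y ^ (m + n) :=
        add_le_add (pow_le_pow_right₀ h.one_le (by omega)) (pow_le_pow_right₀ h.one_le (by omega))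
      _ = y ^ (m + n) * 2 := (mul_two _).symm
      _ ≤ y ^ (m + n) * y :=
        mul_le_mul_of_nonneg_left two_le (pow_nonneg (zero_le_one.trans h.one_le) _)
      _ = y ^ (m + n + 1) := (pow_succ _ _).symm
  | monomial n r =>
    refine ⟨n + 1, ?_⟩
    calc aeval y (monomial n r) = r * y ^ n := aeval_monomial y
      _ ≤ y * y ^ n :=
        mul_le_mul_of_nonneg_right (h.le r.2) (pow_nonneg (zero_le_one.trans h.one_le) n)
      _ = y ^ (n + 1) := (pow_succ' y n).symm

theorem adjoin (h : Dominates R y) (hz : ∀ m : ℕ, y ^ m ≤ z) :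
    Dominates (Algebra.adjoin R {y}).toSubring z where
  nonneg_or_nonpos f hf := by
    rcases h.pos_or_neg_of_mem_adjoin hf with rfl | ⟨hpos, -⟩ | ⟨hneg, -⟩
    exacts [.inl le_rfl, .inl hpos.le, .inr hneg.le]
  le_mul f hf hf0 b hb := by
    obtain ⟨m, hm⟩ := h.exists_le_pow_of_mem_adjoin hb
    have one_le_mul : 1 ≤ f * y := by
      rcases h.pos_or_neg_of_mem_adjoin hf with rfl | ⟨-, hle⟩ | ⟨hneg, -⟩
      exacts [(lt_irrefl 0 hf0).elim, hle, (lt_asymm hf0 hneg).elim]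
    calc b ≤ y ^ m := hm
      _ ≤ f * y * y ^ m :=
        le_mul_of_one_le_left (pow_nonneg (zero_le_one.trans h.one_le) m) one_le_mul
      _ = f * y ^ (m + 1) := by ring
      _ ≤ f * z := mul_le_mul_of_nonneg_left (hz (m + 1)) hf0.le

theorem exists_of_tower {y : ℕ → A} (hR : ∀ n, Dominates R (y n))
    (hy : ∀ n m : ℕ, y (n + 1) ^ m ≤ y n) (i j : ℕ) :
    ∃ L : Subring A, R ≤ L ∧ (∀ n ∈ Set.Ioc i (i + j), y n ∈ L) ∧ Dominates L (y i) := by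
  induction j generalizing i with
  | zero => exact ⟨R, le_rfl, by simp, hR i⟩
  | succ j ih =>
    obtain ⟨L, hRL, hL, hdom⟩ := ih (i + 1)
    have le_adjoin := le_adjoin_toSubring L (y (i + 1))
    refine ⟨_, hRL.trans le_adjoin, fun n hn => ?_, hdom.adjoin (hy i)⟩
    rcases (Nat.succ_le_of_lt hn.1).eq_or_lt with rfl | hin
    · exact Algebra.subset_adjoin rfl
    · exact le_adjoin (hL n ⟨hin, by have := hn.2; omega⟩)

theorem pos_or_neg_of_mem_closure_tower {y : ℕ → A} (hR : ∀ n, Dominates R (y n))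
    (hy : ∀ n m : ℕ, y (n + 1) ^ m ≤ y n) {f : A}
    (hf : f ∈ Subring.closure (R ∪ Set.range y)) :
    f = 0 ∨ (0 < f ∧ 1 ≤ f * y 0) ∨ (f < 0 ∧ 1 ≤ -f * y 0) := by
  obtain ⟨j, hj⟩ := exists_mem_closure_union_image_Iic hf
  obtain ⟨L, hRL, hL, hdom⟩ := exists_of_tower hR hy 0 j
  refine hdom.pos_or_neg_of_mem_adjoin
    (Subring.closure_le (t := (Algebra.adjoin L {y 0}).toSubring) |>.2 ?_ hj)
  rintro _ (hf | ⟨n, hn, rfl⟩)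
  · exact le_adjoin_toSubring L _ (hRL hf)
  · rcases n.eq_zero_or_pos with rfl | hn0
    · exact Algebra.subset_adjoin rfl
    · exact le_adjoin_toSubring L _ (hL n ⟨hn0, by simpa using hn⟩)

end Dominates

end Domination

/-! ### Germs -/

section Germs

theorem coe_mem_differentiableGerms {F : ℝ → ℝ} :
    (F : RGerm) ∈ differentiableGerms ↔ ∀ᶠ t in atTop, DifferentiableAt ℝ F t := by
  constructor
  · rintro ⟨a, G, hG, hFG⟩
    obtain ⟨b, hb⟩ := eventually_atTop.1 (Germ.coe_eq.1 hFG)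
    filter_upwards [eventually_gt_atTop a, eventually_gt_atTop b] with t hat hbt
    refine (hG.differentiableAt (Ioi_mem_nhds hat)).congr_of_eventuallyEq ?_
    filter_upwards [Ioi_mem_nhds hbt] with s hs using hb s hs.le
  · intro h
    obtain ⟨a, ha⟩ := eventually_atTop.1 h
    exact ⟨a, F, fun t ht => (ha t ht.le).differentiableWithinAt, rfl⟩

theorem differentiableGerms_subset_continuousGerms : differentiableGerms ⊆ continuousGerms := by
  rintro _ ⟨a, F, hF, rfl⟩
  exact ⟨a + 1, F, hF.continuousOn.mono (Set.Ici_subset_Ioi.2 (lt_add_one a)), rfl⟩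

theorem isUnit_coe_iff {F : ℝ → ℝ} : IsUnit (F : RGerm) ↔ ∀ᶠ t in atTop, F t ≠ 0 := by
  constructor
  · intro hF
    obtain ⟨g, hg⟩ := hF.exists_right_inv
    induction g using Germ.inductionOn with
    | _ G =>
      filter_upwards [Germ.coe_eq.1 (show ((F * G : ℝ → ℝ) : RGerm) = (1 : ℝ → ℝ) from hg)]
        with t ht
      exact left_ne_zero_of_mul (ht.trans_ne one_ne_zero)
  · intro hF
    refine IsUnit.of_mul_eq_one (F : RGerm)⁻¹ (Germ.coe_eq.2 ?_)
    filter_upwards [hF] with t ht using mul_inv_cancel₀ ht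

theorem mul_inv_cancel_of_isUnit {f : RGerm} (hf : IsUnit f) : f * f⁻¹ = 1 := by
  induction f using Germ.inductionOn with
  | _ F =>
    refine Germ.coe_eq.2 ?_
    filter_upwards [isUnit_coe_iff.1 hf] with t ht using mul_inv_cancel₀ ht

theorem isUnit_of_one_le_mul {f g : RGerm} (h : 1 ≤ f * g) : IsUnit f := by
  induction f, g using Germ.inductionOn₂ with
  | _ F G =>
    refine isUnit_coe_iff.2 ?_
    filter_upwards [show ∀ᶠ t in atTop, 1 ≤ F t * G t from h] with t ht
    exact left_ne_zero_of_mul (zero_lt_one.trans_le ht).ne'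

theorem nonneg_or_nonpos_of_isUnit {f : RGerm} (hf : f ∈ continuousGerms) (hu : IsUnit f) :
    0 ≤ f ∨ f ≤ 0 := by
  obtain ⟨a, F, hF, rfl⟩ := hf
  obtain ⟨b, hb⟩ := eventually_atTop.1 (isUnit_coe_iff.1 hu)
  rcases isPreconnected_Ici.mapsTo_Ioi_or_Iio
    (hF.mono (Set.Ici_subset_Ici.2 (le_max_left a b)))
    (fun t ht => hb t ((le_max_right a b).trans ht)) with hpos | hneg
  · exact .inl ((eventually_ge_atTop (max a b)).mono fun t ht => le_of_lt (hpos ht))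
  · exact .inr ((eventually_ge_atTop (max a b)).mono fun t ht => le_of_lt (hneg ht))

/-- The ring of germs of differentiable functions. -/
def differentiableSubring : Subring RGerm where
  carrier := differentiableGerms
  mul_mem' := by
    intro f g hf hg
    induction f, g using Germ.inductionOn₂ with
    | _ F G =>
      refine coe_mem_differentiableGerms (F := F * G).2 ?_
      filter_upwards [coe_mem_differentiableGerms.1 hf, coe_mem_differentiableGerms.1 hg]
        with t hF hG using hF.mul hG
  add_mem' := by
    intro f g hf hg
    induction f, g using Germ.inductionOn₂ with
    | _ F G =>
      refine coe_mem_differentiableGerms (F := F + G).2 ?_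
      filter_upwards [coe_mem_differentiableGerms.1 hf, coe_mem_differentiableGerms.1 hg]
        with t hF hG using hF.add hG
  neg_mem' := by
    intro f hf
    induction f using Germ.inductionOn with
    | _ F =>
      refine coe_mem_differentiableGerms (F := -F).2 ?_
      filter_upwards [coe_mem_differentiableGerms.1 hf] with t hF using hF.neg
  one_mem' := ⟨0, fun _ => 1, differentiableOn_const 1, rfl⟩
  zero_mem' := ⟨0, fun _ => 0, differentiableOn_const 0, rfl⟩

theorem inv_mem_differentiableGerms {f : RGerm} (hf : f ∈ differentiableGerms) (hu : IsUnit f) :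
    f⁻¹ ∈ differentiableGerms := by
  induction f using Germ.inductionOn with
  | _ F =>
    refine coe_mem_differentiableGerms (F := F⁻¹).2 ?_
    filter_upwards [coe_mem_differentiableGerms.1 hf, isUnit_coe_iff.1 hu] with t hF hF0
      using hF.inv hF0

theorem fractionSubring_le_differentiableSubring {R : Subring RGerm}
    (hR : R ≤ differentiableSubring) : fractionSubring R ≤ differentiableSubring := by
  rintro g ⟨u, hu, v, hv, hv', hgv⟩
  have hg : g = u * v⁻¹ := by rw [← hgv, mul_assoc, mul_inv_cancel_of_isUnit hv', mul_one]
  rw [hg]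
  exact differentiableSubring.mul_mem (hR hu) (inv_mem_differentiableGerms (hR hv) hv')

theorem germDeriv_add {f g : RGerm} (hf : f ∈ differentiableGerms) (hg : g ∈ differentiableGerms) :
    germDeriv (f + g) = germDeriv f + germDeriv g := by
  induction f, g using Germ.inductionOn₂ with
  | _ F G =>
    refine Germ.coe_eq.2 ?_
    filter_upwards [coe_mem_differentiableGerms.1 hf, coe_mem_differentiableGerms.1 hg]
      with t hF hG using deriv_add hF hG

theorem germDeriv_mul {f g : RGerm} (hf : f ∈ differentiableGerms) (hg : g ∈ differentiableGerms) :
    germDeriv (f * g) = germDeriv f * g + f * germDeriv g := by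
  induction f, g using Germ.inductionOn₂ with
  | _ F G =>
    refine Germ.coe_eq.2 ?_
    filter_upwards [coe_mem_differentiableGerms.1 hf, coe_mem_differentiableGerms.1 hg]
      with t hF hG using deriv_mul hF hG

theorem germDeriv_neg (f : RGerm) : germDeriv (-f) = -germDeriv f := by
  induction f using Germ.inductionOn with
  | _ F => exact congrArg ((↑) : (ℝ → ℝ) → RGerm) (funext fun t => deriv.neg)

theorem germDeriv_const (c : ℝ) : germDeriv ((fun _ => c : ℝ → ℝ) : RGerm) = 0 :=
  congrArg ((↑) : (ℝ → ℝ) → RGerm) (deriv_const' c)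

theorem germDeriv_mem_closure {s : Set RGerm} (hs : s ⊆ differentiableGerms)
    (hs' : ∀ f ∈ s, germDeriv f ∈ Subring.closure s) {f : RGerm} (hf : f ∈ Subring.closure s) :
    germDeriv f ∈ Subring.closure s := by
  have hle : Subring.closure s ≤ differentiableSubring := Subring.closure_le.2 hs
  induction hf using Subring.closure_induction with
  | mem f hf => exact hs' f hf
  | zero =>
    rw [show germDeriv 0 = 0 from germDeriv_const 0]
    exact Subring.zero_mem _
  | one =>
    rw [show germDeriv 1 = 0 from germDeriv_const 1]
    exact Subring.zero_mem _
  | add f g hf hg hf' hg' =>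
    rw [germDeriv_add (hle hf) (hle hg)]
    exact Subring.add_mem _ hf' hg'
  | neg f _ hf' =>
    rw [germDeriv_neg]
    exact Subring.neg_mem _ hf'
  | mul f g hf hg hf' hg' =>
    rw [germDeriv_mul (hle hf) (hle hg)]
    exact Subring.add_mem _ (Subring.mul_mem _ hf' hg) (Subring.mul_mem _ hf hg')

end Germs

section Extensions

theorem isHardyField_fractionSubring {R : Subring RGerm} (hR : R ≤ differentiableSubring)
    (hderiv : ∀ f ∈ R, germDeriv f ∈ R) (hunit : ∀ f ∈ R, f ≠ 0 → IsUnit f) :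
    IsHardyField (fractionSubring R) where
  differentiable := fractionSubring_le_differentiableSubring hR
  isField := isField_fractionSubring hunit
  deriv_mem g hg := by
    have hgd := fractionSubring_le_differentiableSubring hR hg
    obtain ⟨u, hu, v, hv, hv', hgv⟩ := hg
    refine ⟨germDeriv u * v - u * germDeriv v,
      R.sub_mem (R.mul_mem (hderiv u hu) hv) (R.mul_mem hu (hderiv v hv)), v * v,
      R.mul_mem hv hv, hv'.mul hv', ?_⟩
    rw [← hgv, germDeriv_mul hgd (hR hv)]
    ring

theorem isHardyField_sInf {S : Set (Subring RGerm)} (hS : S.Nonempty)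
    (h : ∀ K ∈ S, IsHardyField K) : IsHardyField (sInf S) where
  differentiable f hf := by
    obtain ⟨K, hK⟩ := hS
    exact (h K hK).differentiable f (Subring.mem_sInf.1 hf K hK)
  isField := isField_sInf hS fun K hK => (h K hK).isField
  deriv_mem f hf := Subring.mem_sInf.2 fun K hK =>
    (h K hK).deriv_mem f (Subring.mem_sInf.1 hf K hK)

theorem exists_generatesOver_iff {H : Subring RGerm} {y : RGerm} :
    (∃ K, GeneratesOver H y K) ↔ ∃ K, IsHardyField K ∧ H ≤ K ∧ y ∈ K := by
  refine ⟨fun ⟨K, hK⟩ => ⟨K, hK.1⟩, fun hne => ⟨sInf {K | IsHardyField K ∧ H ≤ K ∧ y ∈ K}, ?_⟩⟩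
  refine ⟨⟨isHardyField_sInf hne fun K hK => hK.1, ?_, ?_⟩, fun K hK => sInf_le hK⟩
  · exact le_sInf fun K hK => hK.2.1
  · exact Subring.mem_sInf.2 fun K hK => hK.2.2

theorem IsHardyField.dominates {H : Subring RGerm} (hH : IsHardyField H) {y : RGerm}
    (hy : ∀ h ∈ H, h ≤ y) : Dominates H y := by
  refine .of_isField hH.isField (fun f hf => ?_) hy
  rcases eq_or_ne f 0 with rfl | hf0
  · exact .inl le_rfl
  · obtain ⟨g, -, hfg⟩ := isField_iff_exists_mul_eq_one.1 hH.isField f hf hf0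
    exact nonneg_or_nonpos_of_isUnit
      (differentiableGerms_subset_continuousGerms (hH.differentiable f hf))
      (IsUnit.of_mul_eq_one g hfg)

theorem IsHardyField.exists_generatesOver {H : Subring RGerm} (hH : IsHardyField H)
    {y : ℕ → RGerm} (hdiff : ∀ n, y n ∈ differentiableGerms)
    (hderiv : ∀ n, germDeriv (y n) = y n * y (n + 1)) (hle : ∀ n, ∀ h ∈ H, h ≤ y n)
    (hpow : ∀ n m : ℕ, y (n + 1) ^ m ≤ y n) : ∃ K, GeneratesOver H (y 0) K := by
  set s : Set RGerm := H ∪ Set.range y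
  have hH_le : H ≤ Subring.closure s := fun f hf => Subring.subset_closure (.inl hf)
  have y_mem (n : ℕ) : y n ∈ Subring.closure s := Subring.subset_closure (.inr ⟨n, rfl⟩)
  have hunit : ∀ f ∈ Subring.closure s, f ≠ 0 → IsUnit f := by
    intro f hf hf0
    rcases Dominates.pos_or_neg_of_mem_closure_tower (fun n => hH.dominates (hle n)) hpow hf
      with h | ⟨-, h⟩ | ⟨-, h⟩
    · exact (hf0 h).elim
    · exact isUnit_of_one_le_mul h
    · exact IsUnit.neg_iff f |>.1 (isUnit_of_one_le_mul h)
  have hs : s ⊆ differentiableGerms :=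
    Set.union_subset hH.differentiable (Set.range_subset_iff.2 hdiff)
  have hs' : ∀ f ∈ s, germDeriv f ∈ Subring.closure s := by
    rintro f (hf | ⟨n, rfl⟩)
    · exact hH_le (hH.deriv_mem f hf)
    · rw [hderiv]
      exact Subring.mul_mem _ (y_mem n) (y_mem (n + 1))
  exact exists_generatesOver_iff.2 ⟨fractionSubring (Subring.closure s),
    isHardyField_fractionSubring (Subring.closure_le.2 hs)
      (fun f hf => germDeriv_mem_closure hs hs' hf) hunit,
    hH_le.trans (le_fractionSubring _), le_fractionSubring _ (y_mem 0)⟩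

end Extensions

/-! ### Towers of functions under logarithmic differentiation -/

section LogDeriv

variable {u v : ℝ → ℝ} {s : Set ℝ}

theorem antitoneOn_div_of_logDeriv_le (hs : Convex ℝ s) (hu : ∀ t ∈ s, DifferentiableAt ℝ u t)
    (hv : ∀ t ∈ s, DifferentiableAt ℝ v t) (hu0 : ∀ t ∈ s, 0 < u t) (hv0 : ∀ t ∈ s, 0 < v t)
    (huv : ∀ t ∈ s, logDeriv u t ≤ logDeriv v t) : AntitoneOn (fun t => u t / v t) s := by
  have hdiff (t) (ht : t ∈ s) : DifferentiableAt ℝ (fun t => u t / v t) t :=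
    (hu t ht).fun_div (hv t ht) (hv0 t ht).ne'
  refine antitoneOn_of_deriv_nonpos hs (fun t ht => (hdiff t ht).continuousAt.continuousWithinAt)
    (fun t ht => (hdiff t (interior_subset ht)).differentiableWithinAt) fun t ht => ?_
  replace ht := interior_subset ht
  have hlog : logDeriv (fun t => u t / v t) t = logDeriv u t - logDeriv v t :=
    logDeriv_div t (hu0 t ht).ne' (hv0 t ht).ne' (hu t ht) (hv t ht)
  rw [logDeriv_apply, div_eq_iff (div_pos (hu0 t ht) (hv0 t ht)).ne'] at hlog
  rw [hlog]
  exact mul_nonpos_of_nonpos_of_nonneg (sub_nonpos.2 (huv t ht))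
    (div_pos (hu0 t ht) (hv0 t ht)).le

-- Since `m * f (k + 2) ≤ f (k + 1)`, the quotient `f (k + 1) ^ m / f k` is eventually antitone.
theorem eventually_pow_le_of_logDeriv_tower {f : ℕ → ℝ → ℝ}
    (hf : ∀ k, Tendsto (f k) atTop atTop) (hdiff : ∀ k, Differentiable ℝ (f k))
    (hlog : ∀ k, ∀ᶠ t in atTop, logDeriv (f k) t = f (k + 1) t)
    (hsq : ∀ k, ∀ᶠ t in atTop, f (k + 1) t ^ 2 ≤ f k t) (k m : ℕ) :
    ∀ᶠ t in atTop, f (k + 1) t ^ m ≤ f k t := by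
  have hdecay : ∀ᶠ t in atTop, 0 < f k t ∧ 0 < f (k + 1) t ∧
      logDeriv (fun t => f (k + 1) t ^ (m + 1)) t ≤ logDeriv (f k) t := by
    filter_upwards [(hf k).eventually_gt_atTop 0, (hf (k + 1)).eventually_gt_atTop 0,
      (hf (k + 2)).eventually_ge_atTop (m + 1 : ℝ), hlog k, hlog (k + 1), hsq (k + 1)]
      with t h₀ h₁ h₂ hlog₀ hlog₁ hsq₁
    refine ⟨h₀, h₁, ?_⟩
    rw [logDeriv_fun_pow (hdiff _ t), hlog₀, hlog₁, Nat.cast_add_one]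
    nlinarith
  obtain ⟨a, ha⟩ := eventually_atTop.1 hdecay
  have hanti : AntitoneOn (fun t => f (k + 1) t ^ (m + 1) / f k t) (Set.Ici a) :=
    antitoneOn_div_of_logDeriv_le (convex_Ici a) (fun t _ => (hdiff (k + 1) t).fun_pow (m + 1))
      (fun t _ => hdiff k t) (fun t ht => pow_pos (ha t ht).2.1 _) (fun t ht => (ha t ht).1)
      (fun t ht => (ha t ht).2.2)
  filter_upwards [eventually_ge_atTop a,
    (hf (k + 1)).eventually_ge_atTop (f (k + 1) a ^ (m + 1) / f k a)] with t ht hq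
  obtain ⟨h₀, h₁, -⟩ := ha t ht
  have hle : f (k + 1) t ^ (m + 1) / f k t ≤ f (k + 1) t := (hanti Set.self_mem_Ici ht ht).trans hq
  rw [div_le_iff₀ h₀, pow_succ'] at hle
  exact le_of_mul_le_mul_left hle h₁

end LogDeriv

theorem contDiff_integral {E : Type*} [NormedAddCommGroup E] [NormedSpace ℝ E] [CompleteSpace E]
    {p : ℝ → E} (hp : ContDiff ℝ (⊤ : ℕ∞) p) (a : ℝ) :
    ContDiff ℝ (⊤ : ℕ∞) fun t => ∫ s in a..t, p s := by
  have hderiv (t : ℝ) : HasDerivAt (fun t => ∫ s in a..t, p s) (p t) t :=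
    (hp.continuous.integral_hasStrictDerivAt a t).hasDerivAt
  rw [contDiff_infty_iff_deriv, funext fun t => (hderiv t).deriv]
  exact ⟨fun t => (hderiv t).differentiableAt, hp⟩

section DecayProfile

open Real

/-- A smooth function that equals `1` for `t ≤ 0` and `exp (-(D * t))` for `t ≥ 1`. -/
noncomputable def decayProfile (D t : ℝ) : ℝ :=
  1 - smoothTransition t + smoothTransition t * exp (-(D * t))

variable {D t : ℝ}

theorem contDiff_decayProfile : ContDiff ℝ (⊤ : ℕ∞) (decayProfile D) := by
  have hS : ContDiff ℝ (⊤ : ℕ∞) smoothTransition := smoothTransition.contDiff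
  exact (contDiff_const.sub hS).add (hS.mul (contDiff_const.mul contDiff_id).neg.exp)

theorem decayProfile_of_nonpos (ht : t ≤ 0) : decayProfile D t = 1 := by
  simp [decayProfile, smoothTransition.zero_of_nonpos ht]

theorem decayProfile_of_one_le (ht : 1 ≤ t) : decayProfile D t = exp (-(D * t)) := by
  simp [decayProfile, smoothTransition.one_of_one_le ht]

theorem decayProfile_pos : 0 < decayProfile D t := by
  rcases le_or_gt 1 t with ht | ht
  · rw [decayProfile_of_one_le ht]
    exact exp_pos _
  · exact add_pos_of_pos_of_nonneg (sub_pos.2 (smoothTransition.lt_one_of_lt_one ht))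
      (mul_nonneg (smoothTransition.nonneg t) (exp_pos _).le)

theorem decayProfile_le_one (hD : 0 ≤ D) : decayProfile D t ≤ 1 := by
  rcases le_or_gt t 0 with ht | ht
  · exact (decayProfile_of_nonpos ht).le
  · have hexp : exp (-(D * t)) ≤ 1 := exp_le_one_iff.2 (neg_nonpos.2 (mul_nonneg hD ht.le))
    have := mul_le_mul_of_nonneg_left hexp (smoothTransition.nonneg t)
    rw [decayProfile]
    linarith

theorem neg_deriv_decayProfile : -deriv (decayProfile D) t =
    deriv smoothTransition t * (1 - exp (-(D * t))) +
      smoothTransition t * (D * exp (-(D * t))) := by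
  have hS : HasDerivAt smoothTransition (deriv smoothTransition t) t :=
    (smoothTransition.contDiff (n := 1)).differentiable one_ne_zero t |>.hasDerivAt
  have hexp : HasDerivAt (fun t => exp (-(D * t))) (exp (-(D * t)) * -D) t := by
    simpa using ((hasDerivAt_id t).const_mul D).neg.exp
  rw [show deriv (decayProfile D) t = _ from ((hS.const_sub 1).add (hS.mul hexp)).deriv]
  ring

theorem logDeriv_decayProfile_of_one_le (ht : 1 ≤ t) : logDeriv (decayProfile D) t = -D := by
  have hmax : IsLocalMax smoothTransition t := Filter.Eventually.of_forall fun s =>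
    (smoothTransition.le_one s).trans (smoothTransition.one_of_one_le ht).ge
  have hderiv : -deriv (decayProfile D) t = D * exp (-(D * t)) := by
    rw [neg_deriv_decayProfile, hmax.deriv_eq_zero, smoothTransition.one_of_one_le ht]
    ring
  rw [logDeriv_apply, ← neg_neg (deriv _ t), hderiv, decayProfile_of_one_le ht, neg_div,
    mul_div_cancel_right₀ _ (exp_pos _).ne']

theorem exists_smoothTransition_le_mul : ∃ C : ℝ, ∀ t ∈ Set.Icc (0 : ℝ) 1,
    deriv smoothTransition t ≤ C ∧ smoothTransition t ≤ C * t := by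
  have hS : ContDiff ℝ 1 smoothTransition := smoothTransition.contDiff
  obtain ⟨C, hC⟩ := (isCompact_Icc (a := (0 : ℝ)) (b := 1)).bddAbove_image
    (hS.continuous_deriv le_rfl).continuousOn
  rw [mem_upperBounds, Set.forall_mem_image] at hC
  refine ⟨C, fun t ht => ⟨hC ht, ?_⟩⟩
  simpa [smoothTransition.zero_of_nonpos le_rfl] using
    (convex_Icc (0 : ℝ) 1).image_sub_le_mul_sub_of_deriv_le hS.continuous.continuousOn
      (hS.differentiable one_ne_zero).differentiableOn (fun s hs => hC (interior_subset hs))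
      0 (Set.left_mem_Icc.2 zero_le_one) t ht ht.1

-- The factor `D` is absorbed by `S(t) ≤ C t`, because `D t exp (-D t) ≤ 1`.
theorem exists_forall_neg_deriv_decayProfile_le : ∃ C : ℝ, ∀ D ≥ 0, ∀ t ∈ Set.Icc (0 : ℝ) 1,
    -deriv (decayProfile D) t ≤ C := by
  obtain ⟨C, hC⟩ := exists_smoothTransition_le_mul
  have hC0 : 0 ≤ C := by
    simpa using (smoothTransition.nonneg 1).trans (hC 1 (Set.right_mem_Icc.2 zero_le_one)).2
  refine ⟨C + C, fun D hD t ht => ?_⟩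
  obtain ⟨hderiv, hval⟩ := hC t ht
  have hexp : t * (D * exp (-(D * t))) ≤ 1 := calc
    t * (D * exp (-(D * t))) = D * t * exp (-(D * t)) := by ring
    _ ≤ exp (-1) := mul_exp_neg_le_exp_neg_one (D * t)
    _ ≤ 1 := exp_le_one_iff.2 (by norm_num)
  calc -deriv (decayProfile D) t
      = deriv smoothTransition t * (1 - exp (-(D * t))) +
        smoothTransition t * (D * exp (-(D * t))) := neg_deriv_decayProfile
    _ ≤ C * 1 + C * t * (D * exp (-(D * t))) := by
        gcongr
        · exact sub_nonneg.2 (exp_le_one_iff.2 (neg_nonpos.2 (mul_nonneg hD ht.1)))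
        · exact sub_le_self 1 (exp_pos _).le
    _ = C * 1 + C * (t * (D * exp (-(D * t)))) := by ring
    _ ≤ C * 1 + C * 1 := by gcongr
    _ = C + C := by ring

end DecayProfile

section Tower

open Real

/-- The `k`-th function of the tower on the interval `t ≤ k + 1`, continued to `t ≥ k + 1` with
constant logarithmic derivative `c (k + 1)`. -/
noncomputable def startProfile (c : ℕ → ℝ) (k : ℕ) (t : ℝ) : ℝ :=
  c k / decayProfile (c (k + 1)) (t - k)

/-- The approximants, indexed by the first argument, to the solution `f` of the infinite system
`f k t = startProfile c k t * exp (∫ s in (k + 1)..t, (f (k + 1) s - c (k + 1)))`. -/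
noncomputable def towerApprox (c : ℕ → ℝ) : ℕ → ℕ → ℝ → ℝ
  | 0, k, _ => c k
  | n + 1, k, t =>
    startProfile c k t * exp (∫ s in (k + 1 : ℝ)..t, (towerApprox c n (k + 1) s - c (k + 1)))

/-- The tower of functions with starting values `tower c k t = c k` for `t ≤ k` in which
`tower c (k + 1)` is the logarithmic derivative of `tower c k` from `k + 1` on. At `t` it is given
by any sufficiently late approximant. -/
noncomputable def tower (c : ℕ → ℝ) (k : ℕ) (t : ℝ) : ℝ := towerApprox c ⌈t⌉₊ k t

variable {c : ℕ → ℝ} {k m n : ℕ} {t : ℝ}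

theorem contDiff_startProfile : ContDiff ℝ (⊤ : ℕ∞) (startProfile c k) :=
  contDiff_const.div (contDiff_decayProfile.comp (contDiff_id.sub contDiff_const))
    fun _ => decayProfile_pos.ne'

theorem startProfile_of_le (ht : t ≤ k) : startProfile c k t = c k := by
  rw [startProfile, decayProfile_of_nonpos (sub_nonpos.2 ht), div_one]

theorem startProfile_add_one : startProfile c k (k + 1) = c k * exp (c (k + 1)) := by
  rw [startProfile, add_sub_cancel_left, decayProfile_of_one_le le_rfl, mul_one, exp_neg,
    div_inv_eq_mul]

theorem startProfile_pos (hc : 0 < c k) : 0 < startProfile c k t :=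
  div_pos hc decayProfile_pos

theorem le_startProfile (hc : ∀ k, 0 < c k) : c k ≤ startProfile c k t :=
  le_div_self (hc k).le decayProfile_pos (decayProfile_le_one (hc (k + 1)).le)

theorem logDeriv_startProfile (hc : 0 < c k) :
    logDeriv (startProfile c k) t = -logDeriv (decayProfile (c (k + 1))) (t - k) := by
  have hdiff : DifferentiableAt ℝ (fun t : ℝ => decayProfile (c (k + 1)) (t - k)) t :=
    (contDiff_decayProfile.comp (contDiff_id.sub contDiff_const)).differentiable (by simp) t
  calc logDeriv (startProfile c k) t
      = logDeriv (fun _ => c k) t - logDeriv (fun t : ℝ => decayProfile (c (k + 1)) (t - k)) t :=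
        logDeriv_div t hc.ne' decayProfile_pos.ne' (differentiableAt_const _) hdiff
    _ = -logDeriv (decayProfile (c (k + 1))) (t - k) := by
        rw [logDeriv_const, Pi.zero_apply, zero_sub, logDeriv_apply, deriv_comp_sub_const,
          logDeriv_apply]

theorem logDeriv_startProfile_of_le (hc : 0 < c k) (ht : k + 1 ≤ t) :
    logDeriv (startProfile c k) t = c (k + 1) := by
  rw [logDeriv_startProfile hc, logDeriv_decayProfile_of_one_le (by linarith), neg_neg]

theorem two_mul_logDeriv_startProfile_le {C : ℝ} (hc : 0 < c k)
    (hC : -deriv (decayProfile (c (k + 1))) (t - k) ≤ C) (hCc : 2 * C ≤ c k) :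
    2 * logDeriv (startProfile c k) t ≤ startProfile c k t := by
  rw [logDeriv_startProfile hc, logDeriv_apply, ← neg_div, mul_div_assoc', startProfile]
  exact div_le_div_of_nonneg_right (by linarith) decayProfile_pos.le

theorem contDiff_towerApprox : ContDiff ℝ (⊤ : ℕ∞) (towerApprox c n k) := by
  induction n generalizing k with
  | zero => exact contDiff_const
  | succ n ih =>
    exact contDiff_startProfile.mul (contDiff_integral (ih.sub contDiff_const) _).exp

theorem towerApprox_succ_eq (ht : t ≤ k + n) : towerApprox c (n + 1) k t = towerApprox c n k t := by
  induction n generalizing k t with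
  | zero => simp [towerApprox, startProfile_of_le (by simpa using ht)]
  | succ n ih =>
    rw [towerApprox, towerApprox]
    congr 2
    refine intervalIntegral.integral_congr fun s hs => ?_
    have hs' : s ≤ (k + 1 : ℕ) + n := by
      push_cast at ht ⊢
      exact hs.2.trans (max_le (by linarith [n.cast_nonneg (α := ℝ)]) (by linarith))
    simp only [ih hs']

theorem towerApprox_eq_of_le (hnm : n ≤ m) (ht : t ≤ k + n) :
    towerApprox c m k t = towerApprox c n k t := by
  induction m, hnm using Nat.le_induction with
  | base => rfl
  | succ m hnm ih =>
    rw [towerApprox_succ_eq (ht.trans (by gcongr)), ih]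

theorem tower_eq_towerApprox (ht : t ≤ k + n) : tower c k t = towerApprox c n k t := by
  have hceil : t ≤ k + ⌈t⌉₊ := (Nat.le_ceil t).trans (le_add_of_nonneg_left k.cast_nonneg)
  rw [tower, ← towerApprox_eq_of_le (le_max_left ⌈t⌉₊ n) hceil,
    towerApprox_eq_of_le (le_max_right ⌈t⌉₊ n) ht]

theorem contDiff_tower : ContDiff ℝ (⊤ : ℕ∞) (tower c k) := by
  refine contDiff_iff_contDiffAt.2 fun t => ?_
  obtain ⟨n, hn⟩ := exists_nat_gt t
  refine (contDiff_towerApprox (c := c) (n := n) (k := k)).contDiffAt.congr_of_eventuallyEq ?_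
  filter_upwards [Iio_mem_nhds hn] with s hs
  exact tower_eq_towerApprox (hs.le.trans (le_add_of_nonneg_left k.cast_nonneg))

theorem tower_eq_mul_exp_integral : tower c k t =
    startProfile c k t * exp (∫ s in (k + 1 : ℝ)..t, (tower c (k + 1) s - c (k + 1))) := by
  obtain ⟨n, hn⟩ := exists_nat_ge t
  rw [tower_eq_towerApprox (n := n + 1) (by push_cast; linarith [k.cast_nonneg (α := ℝ)]),
    towerApprox]
  congr 2
  refine intervalIntegral.integral_congr fun s hs => ?_
  have hs' : s ≤ (k + 1 : ℕ) + n := by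
    push_cast
    exact hs.2.trans (max_le (by linarith [n.cast_nonneg (α := ℝ)])
      (by linarith [k.cast_nonneg (α := ℝ)]))
  simp only [tower_eq_towerApprox hs']

theorem tower_of_le (ht : t ≤ k) : tower c k t = c k :=
  tower_eq_towerApprox (n := 0) (by simpa using ht)

theorem tower_of_le_add_one (ht : t ≤ k + 1) : tower c k t = startProfile c k t := by
  have hzero : ∫ s in (k + 1 : ℝ)..t, (tower c (k + 1) s - c (k + 1)) = 0 := by
    refine intervalIntegral.integral_zero_ae (.of_forall fun s hs => ?_)
    rw [tower_of_le, sub_self]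
    rw [Set.uIoc_of_ge ht] at hs
    exact_mod_cast hs.2
  rw [tower_eq_mul_exp_integral, hzero, exp_zero, mul_one]

theorem tower_pos (hc : 0 < c k) : 0 < tower c k t := by
  rw [tower_eq_mul_exp_integral]
  exact mul_pos (startProfile_pos hc) (exp_pos _)

theorem le_tower (hc : ∀ k, 0 < c k) : c k ≤ tower c k t := by
  obtain ⟨n, hn⟩ : ∃ n : ℕ, t ≤ k + n := by
    obtain ⟨n, hn⟩ := exists_nat_ge (t - k)
    exact ⟨n, by linarith⟩
  induction n generalizing k t with
  | zero => rw [tower_of_le (by simpa using hn)]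
  | succ n ih =>
    rcases le_total t (k + 1) with ht | ht
    · rw [tower_of_le_add_one ht]
      exact le_startProfile hc
    · rw [tower_eq_mul_exp_integral]
      refine (le_startProfile hc).trans (le_mul_of_one_le_right (startProfile_pos (hc k)).le
        (one_le_exp (intervalIntegral.integral_nonneg ht fun s hs => sub_nonneg.2 (ih ?_))))
      push_cast at hn ⊢
      linarith [hs.2]

theorem logDeriv_tower_eq_add (hc : 0 < c k) : logDeriv (tower c k) t =
    logDeriv (startProfile c k) t + (tower c (k + 1) t - c (k + 1)) := by
  set E : ℝ → ℝ := fun t => exp (∫ s in (k + 1 : ℝ)..t, (tower c (k + 1) s - c (k + 1)))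
  have hE : HasDerivAt E (E t * (tower c (k + 1) t - c (k + 1))) t :=
    ((contDiff_tower.continuous.sub continuous_const).integral_hasStrictDerivAt _ t).hasDerivAt.exp
  have hE0 : E t ≠ 0 := (exp_pos _).ne'
  calc logDeriv (tower c k) t
      = logDeriv (fun t => startProfile c k t * E t) t := by
        rw [show tower c k = _ from funext fun t => tower_eq_mul_exp_integral]
    _ = logDeriv (startProfile c k) t + logDeriv E t :=
        logDeriv_mul t (startProfile_pos hc).ne' hE0
          (contDiff_startProfile.differentiable (by simp) t) hE.differentiableAt
    _ = logDeriv (startProfile c k) t + (tower c (k + 1) t - c (k + 1)) := by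
        rw [logDeriv_apply E, hE.deriv, mul_div_cancel_left₀ _ hE0]

theorem logDeriv_tower_of_le_add_one (hc : 0 < c k) (ht : t ≤ k + 1) :
    logDeriv (tower c k) t = logDeriv (startProfile c k) t := by
  rw [logDeriv_tower_eq_add hc, tower_of_le (by exact_mod_cast ht), sub_self, add_zero]

theorem logDeriv_tower (hc : 0 < c k) (ht : k + 1 ≤ t) :
    logDeriv (tower c k) t = tower c (k + 1) t := by
  rw [logDeriv_tower_eq_add hc, logDeriv_startProfile_of_le hc ht, add_sub_cancel]

theorem sq_tower_succ_le {b : ℝ} (hc : ∀ k, 0 < c k)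
    (hb : ∀ t ∈ Set.Icc (k + 1 : ℝ) b, 2 * logDeriv (tower c (k + 1)) t ≤ tower c (k + 1) t)
    (ht : t ∈ Set.Icc (k + 1 : ℝ) b) (hck : 2 ≤ c k) : tower c (k + 1) t ^ 2 ≤ tower c k t := by
  have hdiff (k : ℕ) (t : ℝ) : DifferentiableAt ℝ (tower c k) t :=
    contDiff_tower.differentiable (by simp) t
  have hanti :
      AntitoneOn (fun t => tower c (k + 1) t ^ 2 / tower c k t) (Set.Icc (k + 1 : ℝ) b) := by
    refine antitoneOn_div_of_logDeriv_le (convex_Icc _ _) (fun t _ => (hdiff (k + 1) t).fun_pow 2)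
      (fun t _ => hdiff k t) (fun t _ => pow_pos (tower_pos (hc _)) 2)
      (fun t _ => tower_pos (hc k)) fun t ht => ?_
    rw [logDeriv_fun_pow (hdiff _ t), logDeriv_tower (hc k) ht.1]
    exact hb t ht
  have hinit : tower c (k + 1) (k + 1) ^ 2 ≤ tower c k (k + 1) := by
    rw [tower_of_le (by push_cast; rfl), tower_of_le_add_one le_rfl, startProfile_add_one]
    have hexp := quadratic_le_exp_of_nonneg (hc (k + 1)).le
    nlinarith [hc (k + 1), exp_pos (c (k + 1))]
  have hle := (hanti ⟨le_rfl, ht.1.trans ht.2⟩ ht ht.1).trans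
    (div_le_one_of_le₀ hinit (tower_pos (hc k)).le)
  rwa [div_le_one (tower_pos (hc k))] at hle

-- On `[k + 1, t]` the inequality for `k + 1` gives `f (k + 1) ^ 2 ≤ f k`, whence
-- `2 * f (k + 1) ≤ f k`, which is the inequality for `k`.
theorem two_mul_logDeriv_tower_le (hc : ∀ k, 2 ≤ c k)
    (hstart : ∀ k : ℕ, ∀ t ∈ Set.Icc (k : ℝ) (k + 1),
      2 * logDeriv (startProfile c k) t ≤ startProfile c k t) (hkt : k ≤ t) :
    2 * logDeriv (tower c k) t ≤ tower c k t := by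
  have hc0 (k : ℕ) : 0 < c k := two_pos.trans_le (hc k)
  obtain ⟨n, hn⟩ := exists_nat_ge (t - k)
  induction n generalizing k t with
  | zero =>
    have ht : t ≤ k + 1 := by
      rw [Nat.cast_zero] at hn
      linarith
    rw [logDeriv_tower_of_le_add_one (hc0 k) ht, tower_of_le_add_one ht]
    exact hstart k t ⟨hkt, ht⟩
  | succ n ih =>
    rcases le_total t (k + 1) with ht | ht
    · rw [logDeriv_tower_of_le_add_one (hc0 k) ht, tower_of_le_add_one ht]
      exact hstart k t ⟨hkt, ht⟩
    · have hsq : tower c (k + 1) t ^ 2 ≤ tower c k t :=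
        sq_tower_succ_le hc0 (fun s hs => ih (by exact_mod_cast hs.1)
          (by push_cast at hn ⊢; linarith [hs.2])) ⟨ht, le_rfl⟩ (hc k)
      have htwo : 2 ≤ tower c (k + 1) t := (hc (k + 1)).trans (le_tower hc0)
      rw [logDeriv_tower (hc0 k) ht]
      nlinarith

theorem tower_le_tower (hc : ∀ k, 2 ≤ c k)
    (hsq : ∀ (k : ℕ) (t : ℝ), k + 1 ≤ t → tower c (k + 1) t ^ 2 ≤ tower c k t)
    (hkm : k ≤ m) (hmt : m ≤ t) : tower c m t ≤ tower c k t := by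
  induction m, hkm using Nat.le_induction with
  | base => exact le_rfl
  | succ m _ ih =>
    push_cast at hmt
    have htwo : 2 ≤ tower c (m + 1) t :=
      (hc (m + 1)).trans (le_tower fun k => two_pos.trans_le (hc k))
    calc tower c (m + 1) t ≤ tower c (m + 1) t ^ 2 := le_self_pow₀ (by linarith) two_ne_zero
      _ ≤ tower c m t := hsq m t hmt
      _ ≤ tower c k t := ih (by linarith)

theorem exists_startValues {ψ : ℝ → ℝ} (hψ : Continuous ψ) : ∃ c : ℕ → ℝ, (∀ k, 2 ≤ c k) ∧
    (∀ k : ℕ, k ≤ c k) ∧ (∀ k : ℕ, ∀ t ∈ Set.Icc (k : ℝ) (k + 1), ψ t < c k) ∧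
    ∀ k : ℕ, ∀ t ∈ Set.Icc (k : ℝ) (k + 1),
      2 * logDeriv (startProfile c k) t ≤ startProfile c k t := by
  obtain ⟨C, hC⟩ := exists_forall_neg_deriv_decayProfile_le
  have hbound (k : ℕ) : ∃ B, ∀ t ∈ Set.Icc (k : ℝ) (k + 1), ψ t ≤ B := by
    obtain ⟨B, hB⟩ := (isCompact_Icc (a := (k : ℝ)) (b := k + 1)).bddAbove_image hψ.continuousOn
    exact ⟨B, fun t ht => hB (Set.mem_image_of_mem ψ ht)⟩
  choose B hB using hbound
  have hc (k : ℕ) : ∃ b : ℝ, 2 ≤ b ∧ k ≤ b ∧ B k < b ∧ 2 * C ≤ b :=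
    ((eventually_ge_atTop 2).and ((eventually_ge_atTop (k : ℝ)).and
      ((eventually_gt_atTop (B k)).and (eventually_ge_atTop (2 * C))))).exists
  choose c h2 hk hBc hCc using hc
  have hc0 (k : ℕ) : 0 < c k := two_pos.trans_le (h2 k)
  refine ⟨c, h2, hk, fun k t ht => (hB k t ht).trans_lt (hBc k), fun k t ht => ?_⟩
  exact two_mul_logDeriv_startProfile_le (hc0 k) (hC _ (hc0 _).le _
    ⟨sub_nonneg.2 ht.1, by linarith [ht.2]⟩) (hCc k)

theorem exists_logDeriv_tower {ψ : ℝ → ℝ} (hψ : Continuous ψ) : ∃ f : ℕ → ℝ → ℝ,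
    (∀ k, ContDiff ℝ (⊤ : ℕ∞) (f k)) ∧ (∀ k, ∀ᶠ t in atTop, deriv (f k) t = f k t * f (k + 1) t) ∧
    (∀ k, ∀ᶠ t in atTop, ψ t < f k t) ∧ ∀ k m : ℕ, ∀ᶠ t in atTop, f (k + 1) t ^ m ≤ f k t := by
  obtain ⟨c, hc, hk, hψc, hstart⟩ := exists_startValues hψ
  have hc0 (k : ℕ) : 0 < c k := two_pos.trans_le (hc k)
  have hsq (k : ℕ) (t : ℝ) (ht : k + 1 ≤ t) : tower c (k + 1) t ^ 2 ≤ tower c k t :=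
    sq_tower_succ_le hc0 (fun s hs => two_mul_logDeriv_tower_le hc hstart
      (by exact_mod_cast hs.1)) ⟨ht, le_rfl⟩ (hc k)
  have hfloor (k : ℕ) : ∀ᶠ t in atTop, c ⌊t⌋₊ ≤ tower c k t := by
    filter_upwards [eventually_ge_atTop (k : ℝ)] with t ht
    exact (le_tower hc0).trans (tower_le_tower hc hsq (Nat.le_floor ht)
      (Nat.floor_le (k.cast_nonneg.trans ht)))
  have htendsto (k : ℕ) : Tendsto (tower c k) atTop atTop :=
    tendsto_atTop_mono' atTop ((hfloor k).mono fun t ht => (hk ⌊t⌋₊).trans ht)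
      (tendsto_natCast_atTop_atTop.comp tendsto_nat_floor_atTop)
  have hlog (k : ℕ) : ∀ᶠ t in atTop, logDeriv (tower c k) t = tower c (k + 1) t :=
    (eventually_ge_atTop (k + 1 : ℝ)).mono fun t ht => logDeriv_tower (hc0 k) ht
  refine ⟨tower c, fun k => contDiff_tower, fun k => ?_, fun k => ?_, ?_⟩
  · filter_upwards [hlog k] with t ht
    rw [← ht, logDeriv_apply, mul_div_cancel₀ _ (tower_pos (hc0 k)).ne']
  · filter_upwards [hfloor k, eventually_ge_atTop 0] with t ht ht0
    exact (hψc _ t ⟨Nat.floor_le ht0, (Nat.lt_floor_add_one t).le⟩).trans_le ht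
  · exact eventually_pow_le_of_logDeriv_tower htendsto
      (fun k => contDiff_tower.differentiable (by simp)) hlog
      fun k => (eventually_ge_atTop (k + 1 : ℝ)).mono (hsq k)

end Tower

end HardyFields

open HardyFields Filter in
theorem mainTheorem5_general {H : Subring HardyFields.RGerm} (hH : HardyFields.IsHardyField H)
    {φ : HardyFields.RGerm} (hφ : φ ∈ HardyFields.continuousGerms)
    (hφH : ∀ h ∈ H, HardyFields.EventuallyLT h φ) :
    ∃ y ∈ HardyFields.smoothGerms ⊤, HardyFields.EventuallyLT φ y ∧
      ∃ K : Subring HardyFields.RGerm, HardyFields.GeneratesOver H y K := by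
  obtain ⟨a, F, hF, rfl⟩ := hφ
  have hψ : Continuous fun t => F (max a t) :=
    hF.comp_continuous (continuous_const.max continuous_id) fun t => le_max_left a t
  obtain ⟨f, hsmooth, hderiv, hψf, hpow⟩ := exists_logDeriv_tower hψ
  have hFf (n : ℕ) : EventuallyLT (F : RGerm) (f n) := by
    filter_upwards [hψf n, eventually_ge_atTop a] with t ht hat
    rwa [max_eq_right hat] at ht
  refine ⟨f 0, ⟨0, f 0, (hsmooth 0).contDiffOn, rfl⟩, hFf 0,
    hH.exists_generatesOver (y := fun n => (f n : RGerm))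
      (fun n => ⟨0, f n, ((hsmooth n).differentiable (by simp)).differentiableOn, rfl⟩)
      (fun n => Germ.coe_eq.2 (hderiv n)) (fun n h hh => ?_) hpow⟩
  have hhF := hφH h hh
  induction h using Germ.inductionOn with
  | _ h => exact (hhF.and (hFf n)).mono fun t ht => (ht.1.trans ht.2).le

theorem mainTheorem5 (H : Subring HardyFields.RGerm)
    (hH : HardyFields.IsLiouvilleClosed H) (hR : HardyFields.ContainsReals H)
    (φ : HardyFields.RGerm) (hφ : φ ∈ HardyFields.continuousGerms)
    (hφH : ∀ h ∈ H, HardyFields.EventuallyLT h φ) :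
    ∃ y ∈ HardyFields.smoothGerms ⊤, HardyFields.EventuallyLT φ y ∧
      ∃ K : Subring HardyFields.RGerm, HardyFields.GeneratesOver H y K :=
  mainTheorem5_general hH.toIsHardyField hφ hφH
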